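/- For real $\theta,\phi,\eta$ let $$U_{\theta,\phi}=\begin{bmatrix}\cos\theta&-ie^{i\phi}\sin\theta\\-ie^{-i\phi}\sin\theta&\cos\theta\end{bmatrix},\qquad Q_\eta=\operatorname{diag}(1,1,1,e^{i\eta}),$$ written in the bases $|0\rangle,|1\rangle$ of $\mathbb C^2$ and $|00\rangle,|01\rangle,|10\rangle,|11\rangle$ of $\mathbb C^2\otimes\mathbb C^2$. A $k$-bit gate is a unitary operator on $(\mathbb C^2)^{\otimes k}$. For a 1-bit gate $A$ and a 2-bit gate $B$, let $A(j)$ and $B(j,k)$ ($j\neq k$) be the operators on $(\mathbb C^2)^{\otimes n}$ that act as $A$ on the $j$-th factor, respectively as $B$ on the $j$-th and $k$-th factors (in this order), and as the identity on the remaining factors. A collection of 1-bit gates $A_i$ and 2-bit gates $B_j$ is called (exactly) universal if, for every $n\ge2$, every $n$-bit gate is a finite composition of operators $A_i(\ell)$ and $B_j(\ell,m)$, $1\le\ell,m\le n$, $\ell\ne m$. **Theorem 3.4.** (a) The 1-bit gates $U_{\theta,\phi}$, $0\le\theta,\phi\le2\pi$, together with the 2-bit gates $Q_\eta$, $0\le\eta\le2\pi$,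 form a universal collection. (b) In terms of the devices: let $\Omega,\hbar,g>0$ and let $\omega,\nu$ be real with $\Delta:=\nu-\omega\ne0$ and $E:=\hbar\left(-\frac{\omega}{2}+\nu+\frac{g^2}{\Delta}\right)\neq0$. Then the 1-bit gates $U_{\theta,\phi}$ with $\theta=\frac{\Omega}{2}t$, $t\ge0$, $0\le\phi\le2\pi$ (two-level atom with Rabi frequency $\Omega$, driven at resonance for a time $t$), together with the 2-bit gates $Q_\eta$ with $\eta=-\frac{E}{\hbar}t$, $t\ge0$ (cavity QED with atomic transition frequency $\omega$, cavity frequency $\nu$, coupling constant $g$ and interaction time $t$), form a universal collection. -/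

import Mathlib

noncomputable section

/-- `n`-bit operators, as matrices in the computational basis `|x₁ x₂ … xₙ⟩`, `xᵢ ∈ {0, 1}`;
a basis vector is indexed by its bit string `x : Fin n → Fin 2`. The `n`-bit gates are the
unitary ones among them. -/
abbrev NBitOp (n : ℕ) : Type := Matrix (Fin n → Fin 2) (Fin n → Fin 2) ℂ

/-- `1`-bit operators in the basis `|0⟩, |1⟩`. -/
abbrev OneBitOp : Type := Matrix (Fin 2) (Fin 2) ℂ

/-- `2`-bit operators in the basis `|00⟩, |01⟩, |10⟩, |11⟩`, where `|x y⟩` has index `(x, y)`. -/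
abbrev TwoBitOp : Type := Matrix (Fin 2 × Fin 2) (Fin 2 × Fin 2) ℂ

/-- `A(j)`: the `1`-bit operator `A` acting on slot `j` of `n` qubits, the identity elsewhere. -/
def oneBitAt {n : ℕ} (A : OneBitOp) (j : Fin n) : NBitOp n :=
  Matrix.of fun x y => if ∀ i, i ≠ j → x i = y i then A (x j) (y j) else 0

/-- `B(j, k)`: the `2`-bit operator `B` acting on slots `j` and `k` (in this order) of `n` qubits,
the identity elsewhere. It is only used for `j ≠ k`. -/
def twoBitAt {n : ℕ} (B : TwoBitOp) (j k : Fin n) : NBitOp n :=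
  Matrix.of fun x y =>
    if ∀ i, i ≠ j → i ≠ k → x i = y i then B (x j, x k) (y j, y k) else 0

/-- The elementary operations on `n` qubits offered by a collection `S` of `1`-bit gates and a
collection `T` of `2`-bit gates: the `A(j)` with `A ∈ S` and the `B(j, k)` with `B ∈ T`, `j ≠ k`. -/
def elementaryOps (S : Set OneBitOp) (T : Set TwoBitOp) (n : ℕ) : Set (NBitOp n) :=
  {M | (∃ A ∈ S, ∃ j : Fin n, M = oneBitAt A j) ∨
    (∃ B ∈ T, ∃ j k : Fin n, j ≠ k ∧ M = twoBitAt B j k)}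

/-- A collection of `1`-bit gates `S` and `2`-bit gates `T` (all unitary) is (exactly) universal
if, for each `n ≥ 2`, every `n`-bit gate is a finite composition of gates `A(j)`, `A ∈ S`, and
`B(j, k)`, `B ∈ T`. -/
def IsUniversalGateSet (S : Set OneBitOp) (T : Set TwoBitOp) : Prop :=
  (∀ A ∈ S, A ∈ Matrix.unitaryGroup (Fin 2) ℂ) ∧
  (∀ B ∈ T, B ∈ Matrix.unitaryGroup (Fin 2 × Fin 2) ℂ) ∧
  ∀ n : ℕ, 2 ≤ n → ∀ W ∈ Matrix.unitaryGroup (Fin n → Fin 2) ℂ,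
    ∃ L : List (NBitOp n), (∀ M ∈ L, M ∈ elementaryOps S T n) ∧ L.prod = W

/-- The `1`-bit unitary rotation gate `U_{θ, φ}`. -/
def rotationGate (θ φ : ℝ) : OneBitOp :=
  !![(Real.cos θ : ℂ), -Complex.I * Complex.exp (Complex.I * φ) * Real.sin θ;
     -Complex.I * Complex.exp (-(Complex.I * φ)) * Real.sin θ, (Real.cos θ : ℂ)]

/-- The `2`-bit quantum phase gate `Q_η = diag(1, 1, 1, e^{iη})`. -/
def phaseGate (η : ℝ) : TwoBitOp :=
  Matrix.diagonal fun x => if x = (1, 1) then Complex.exp (Complex.I * η) else 1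

/-- The energy level `E₋₍₁₎ = ħ (-ω/2 + ν + g²/Δ)` of the state `|1, 1⟩` of atom and cavity in the
dispersive regime: `ω` is the atomic transition frequency, `ν` the cavity frequency,
`Δ = ν - ω` the detuning, `g` the coupling constant. -/
def cavityEnergy (ħ ω ν g : ℝ) : ℝ :=
  ħ * (-(ω / 2) + ν + g ^ 2 / (ν - ω))

/-- The gates produced by a resonantly driven two-level atom with Rabi frequency `Ω`:
interaction for a time `t ≥ 0` gives the rotation with `θ = Ω t / 2`, and the phase `φ` is free. -/
def twoLevelAtomGates (Ω : ℝ) : Set OneBitOp :=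
  {A | ∃ t φ : ℝ, 0 ≤ t ∧ 0 ≤ φ ∧ φ ≤ 2 * Real.pi ∧ A = rotationGate (Ω / 2 * t) φ}

/-- The gates produced by the atom-cavity interaction: interaction for a time `t ≥ 0` gives the
phase gate with `η = -E₋₍₁₎ t / ħ`. -/
def cavityGates (ħ ω ν g : ℝ) : Set TwoBitOp :=
  {B | ∃ t : ℝ, 0 ≤ t ∧ B = phaseGate (-(cavityEnergy ħ ω ν g / ħ) * t)}

end

/-!
Conjugating `Q_π` on the target qubit by the gate `U_{π/4, -π/2}` gives the controlled-not, and the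
rotations `U_{θ, φ}` generate the evolutions `exp (i t Z)` of Pauli `Z`. Conjugating such an
evolution by controlled-nots replaces the diagonal Hamiltonian `Z` by all nonconstant Walsh
functions, and the generator of `Q_η` adds the constants; Walsh functions span the real functions on
bit strings, so every diagonal unitary is reached. Hence so is every multiplexed rotation, whose
angles depend on the contents of the other qubits, and such rotations clear the bits of any vector
one after the other until it is a multiple of `|0…0⟩`. Conjugating by them a phase on a single basis
vector gives every complex reflection, and by Householder's argument every unitary is a product of
complex reflections. The gates depend on their angles only modulo `2 π`, so the bounded angles of
(a) and the interaction times `t ≥ 0` of (b) yield the same gates as arbitrary real angles.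
-/

open Complex Matrix

section PhaseDiagonal

variable {ι : Type*} [DecidableEq ι]

/-- The diagonal unitary `|x⟩ ↦ exp (i f x) |x⟩`, the evolution of a Hamiltonian which is diagonal
in the computational basis. Its phases are real functions, so that they form a vector space. -/
noncomputable def phaseDiagonal (f : ι → ℝ) : Matrix ι ι ℂ :=
  diagonal fun x => exp (I * f x)

theorem phaseDiagonal_zero : phaseDiagonal (0 : ι → ℝ) = 1 := by
  simp [phaseDiagonal]

theorem star_phaseDiagonal (f : ι → ℝ) : star (phaseDiagonal f) = phaseDiagonal (-f) := by
  simp only [phaseDiagonal, star_eq_conjTranspose, diagonal_conjTranspose]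
  congr 1
  ext x
  simp [← exp_conj]

theorem phaseDiagonal_single_arg {z : ℂ} (hz : ‖z‖ = 1) (i : ι) :
    phaseDiagonal (Pi.single i z.arg) = diagonal (Function.update 1 i z) := by
  have hexp : exp (I * z.arg) = z := by
    simpa [hz, mul_comm] using norm_mul_exp_arg_mul_I z
  rw [phaseDiagonal]
  congr 1
  ext x
  rcases eq_or_ne x i with rfl | hx
  · simp [hexp]
  · simp [hx]

variable [Fintype ι]

theorem phaseDiagonal_add (f g : ι → ℝ) :
    phaseDiagonal (f + g) = phaseDiagonal f * phaseDiagonal g := by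
  simp only [phaseDiagonal, diagonal_mul_diagonal, ← exp_add, ← mul_add, Pi.add_apply, ofReal_add]

theorem phaseDiagonal_mulVec (f : ι → ℝ) (v : ι → ℂ) (x : ι) :
    (phaseDiagonal f *ᵥ v) x = exp (I * f x) * v x := by
  rw [phaseDiagonal, mulVec_diagonal]

theorem phaseDiagonal_mem_unitaryGroup (f : ι → ℝ) : phaseDiagonal f ∈ unitaryGroup ι ℂ := by
  rw [mem_unitaryGroup_iff, star_phaseDiagonal, ← phaseDiagonal_add, add_neg_cancel,
    phaseDiagonal_zero]

end PhaseDiagonal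

section ComplexReflection

variable {ι R : Type*} [CommRing R] [StarRing R]

theorem star_sub_dotProduct_sub [Fintype ι] {u v : ι → R}
    (huv : star u ⬝ᵥ u = star v ⬝ᵥ v) :
    star (u - v) ⬝ᵥ (u - v) = star (u - v) ⬝ᵥ u + star (star (u - v) ⬝ᵥ u) := by
  rw [← star_dotProduct]
  simp only [star_sub, sub_dotProduct, dotProduct_sub]
  linear_combination -huv

variable [DecidableEq ι]

theorem star_mulVec_dotProduct_mulVec [Fintype ι] {M : Matrix ι ι R}
    (hM : M ∈ unitaryGroup ι R) (v w : ι → R) : star (M *ᵥ v) ⬝ᵥ (M *ᵥ w) = star v ⬝ᵥ w := by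
  rw [star_mulVec, ← dotProduct_mulVec, mulVec_mulVec, ← star_eq_conjTranspose,
    mem_unitaryGroup_iff'.1 hM, one_mulVec]

/-- The complex reflection `1 - α d d*`: it fixes the orthogonal complement of `d` and multiplies
`d` by `1 - α d*d`. Neither `d` nor `α` is normalized, so over `ℂ` it is unitary only if that
factor has modulus one. -/
def complexReflection (α : R) (d : ι → R) : Matrix ι ι R :=
  1 - α • vecMulVec d (star d)

theorem complexReflection_single (α c : R) (i : ι) :
    complexReflection α (Pi.single i c) =
      diagonal (Function.update 1 i (1 - α * (star c * c))) := by
  ext x y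
  rcases eq_or_ne x i with rfl | hx <;> rcases eq_or_ne y x with rfl | hy <;>
    simp_all [complexReflection, vecMulVec_apply, one_apply, Pi.single_apply, eq_comm, mul_comm]

variable [Fintype ι]

theorem complexReflection_mulVec (α : R) (d w : ι → R) :
    complexReflection α d *ᵥ w = w - (α * (star d ⬝ᵥ w)) • d := by
  simp only [complexReflection, sub_mulVec, one_mulVec, smul_mulVec, vecMulVec_mulVec,
    op_smul_eq_smul, smul_smul]

theorem star_mul_complexReflection_mul {M : Matrix ι ι R} (hM : M ∈ unitaryGroup ι R) (α : R)
    (d : ι → R) : star M * complexReflection α (M *ᵥ d) * M = complexReflection α d := by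
  refine mulVec_injective (funext fun v => ?_)
  simp only [← mulVec_mulVec, complexReflection_mulVec, star_mulVec_dotProduct_mulVec hM,
    mulVec_sub, mulVec_smul]
  simp only [mulVec_mulVec, mem_unitaryGroup_iff'.1 hM, one_mulVec]

variable {P : Submonoid (Matrix ι ι ℂ)}

theorem complexReflection_mem (hP : P ≤ unitaryGroup ι ℂ) (hstar : ∀ M ∈ P, star M ∈ P)
    (hdiag : ∀ f, phaseDiagonal f ∈ P) {d : ι → ℂ}
    (hd : ∃ M ∈ P, ∃ i c, M *ᵥ d = Pi.single i c) {α : ℂ} (hα : ‖1 - α * (star d ⬝ᵥ d)‖ = 1) :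
    complexReflection α d ∈ P := by
  obtain ⟨M, hM, i, c, hMd⟩ := hd
  have hnorm : star d ⬝ᵥ d = star c * c := by
    rw [← star_mulVec_dotProduct_mulVec (hP hM), hMd]
    simp
  rw [hnorm] at hα
  rw [← star_mul_complexReflection_mul (hP hM), hMd, complexReflection_single,
    ← phaseDiagonal_single_arg hα]
  exact mul_mem (mul_mem (hstar M hM) (hdiag _)) hM

open scoped ComplexOrder in
theorem exists_mem_mulVec_eq (hP : P ≤ unitaryGroup ι ℂ) (hstar : ∀ M ∈ P, star M ∈ P)
    (hdiag : ∀ f, phaseDiagonal f ∈ P) (hsingle : ∀ v, ∃ M ∈ P, ∃ i c, M *ᵥ v = Pi.single i c)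
    {u v : ι → ℂ} (huv : star u ⬝ᵥ u = star v ⬝ᵥ v) :
    ∃ R ∈ P, R *ᵥ u = v ∧ ∀ w, star u ⬝ᵥ w = 0 → star v ⬝ᵥ w = 0 → R *ᵥ w = w := by
  have hdd := star_sub_dotProduct_sub huv
  set β := star (u - v) ⬝ᵥ u with hβ
  rcases eq_or_ne β 0 with h0 | h0
  · rw [h0, star_zero, add_zero, dotProduct_star_self_eq_zero, sub_eq_zero] at hdd
    exact ⟨1, one_mem P, by rw [one_mulVec, hdd], fun w _ _ => one_mulVec w⟩
  · -- The factor of the reflection along `u - v` is `-star β / β`, a phase.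
    have hnorm : ‖1 - β⁻¹ * (star (u - v) ⬝ᵥ (u - v))‖ = 1 := by
      rw [hdd, mul_add, inv_mul_cancel₀ h0, sub_add_cancel_left, norm_neg, norm_mul, norm_inv,
        norm_star, inv_mul_cancel₀ (norm_ne_zero_iff.2 h0)]
    refine ⟨complexReflection β⁻¹ (u - v),
      complexReflection_mem hP hstar hdiag (hsingle _) hnorm, ?_, fun w hu hv => ?_⟩
    · rw [complexReflection_mulVec, ← hβ, inv_mul_cancel₀ h0, one_smul, sub_sub_cancel]
    · rw [complexReflection_mulVec, star_sub, sub_dotProduct, hu, hv, sub_zero, mul_zero,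
        zero_smul, sub_zero]

theorem exists_mem_mul_mulVec_single_eq (hP : P ≤ unitaryGroup ι ℂ)
    (hstar : ∀ M ∈ P, star M ∈ P) (hdiag : ∀ f, phaseDiagonal f ∈ P)
    (hsingle : ∀ v, ∃ M ∈ P, ∃ i c, M *ᵥ v = Pi.single i c) {W : Matrix ι ι ℂ}
    (hW : W ∈ unitaryGroup ι ℂ) (s : Finset ι) :
    ∃ M ∈ P, ∀ y ∈ s, (M * W) *ᵥ Pi.single y 1 = Pi.single y 1 := by
  induction s using Finset.induction_on with
  | empty => exact ⟨1, one_mem P, by simp⟩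
  | insert z s hz ih =>
    obtain ⟨M, hM, hMW⟩ := ih
    have hinner := star_mulVec_dotProduct_mulVec (mul_mem (hP hM) hW)
    obtain ⟨R, hR, hRz, hRfix⟩ := exists_mem_mulVec_eq hP hstar hdiag hsingle
      (hinner (Pi.single z 1) (Pi.single z 1))
    refine ⟨R * M, mul_mem hR hM, fun y hy => ?_⟩
    rw [mul_assoc, ← mulVec_mulVec]
    rcases Finset.mem_insert.1 hy with rfl | hys
    · exact hRz
    · have horth : star (Pi.single z (1 : ℂ)) ⬝ᵥ Pi.single y 1 = 0 := by
        simp [ne_of_mem_of_not_mem hys hz]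
      have horth' := hinner (Pi.single z 1) (Pi.single y 1)
      rw [hMW y hys, horth] at horth'
      rw [hMW y hys, hRfix _ horth' horth]

/-- Householder's argument: the hypothesis `hsingle` conjugates any complex reflection to a
diagonal one, and reflections turn the columns of a unitary into the standard basis one by one. -/
theorem unitaryGroup_le_of_exists_mulVec_eq_single (hP : P ≤ unitaryGroup ι ℂ)
    (hstar : ∀ M ∈ P, star M ∈ P) (hdiag : ∀ f, phaseDiagonal f ∈ P)
    (hsingle : ∀ v, ∃ M ∈ P, ∃ i c, M *ᵥ v = Pi.single i c) : unitaryGroup ι ℂ ≤ P := by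
  intro W hW
  obtain ⟨M, hM, hMW⟩ :=
    exists_mem_mul_mulVec_single_eq hP hstar hdiag hsingle hW Finset.univ
  have hMW_one : M * W = 1 := ext_of_mulVec_single fun y => by
    rw [hMW y (Finset.mem_univ y), one_mulVec]
  rw [← left_inv_eq_right_inv (mem_unitaryGroup_iff'.1 (hP hM)) hMW_one]
  exact hstar M hM

end ComplexReflection

section Multiplexed

theorem blockDiagonal_mulVec_apply {o m R : Type*} [DecidableEq o] [Fintype o] [Fintype m]
    [NonUnitalNonAssocSemiring R] (A : o → Matrix m m R) (w : m × o → R) (x : m × o) :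
    (blockDiagonal A *ᵥ w) x = ∑ b, A x.2 x.1 b * w (b, x.2) := by
  simp [mulVec, dotProduct, Fintype.sum_prod_type, blockDiagonal_apply, ite_mul]

theorem funSplitAt_symm_eq_update {κ m : Type*} [DecidableEq κ] (j : κ) (x : κ → m) (b : m) :
    (Equiv.funSplitAt j m).symm (b, fun i => x i) = Function.update x j b := by
  ext i
  rcases eq_or_ne i j with rfl | hi <;> simp [Equiv.funSplitAt, Equiv.piSplitAt, *]

variable {κ m R : Type*} [DecidableEq κ] [DecidableEq m] [Fintype κ]

/-- The uniformly controlled (multiplexed) operator on slot `j`: on the part of the space where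
the other slots contain `r`, it acts as `A r` on slot `j`. -/
def multiplexed [Zero R] (j : κ) (A : ({i // i ≠ j} → m) → Matrix m m R) :
    Matrix (κ → m) (κ → m) R :=
  (blockDiagonal A).submatrix (Equiv.funSplitAt j m) (Equiv.funSplitAt j m)

theorem multiplexed_diagonal [Zero R] (j : κ) (d : ({i // i ≠ j} → m) → m → R) :
    multiplexed j (fun r => diagonal (d r)) = diagonal fun x => d (fun i => x i) (x j) := by
  rw [multiplexed, blockDiagonal_diagonal, submatrix_diagonal_equiv]
  rfl

theorem star_multiplexed [AddMonoid R] [StarAddMonoid R] (j : κ)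
    (A : ({i // i ≠ j} → m) → Matrix m m R) :
    star (multiplexed j A) = multiplexed j fun r => star (A r) := by
  simp only [multiplexed, star_eq_conjTranspose, conjTranspose_submatrix,
    blockDiagonal_conjTranspose]

theorem multiplexed_phaseDiagonal (j : κ) (f : ({i // i ≠ j} → m) → m → ℝ) :
    multiplexed j (fun r => phaseDiagonal (f r)) =
      phaseDiagonal fun x => f (fun i => x i) (x j) :=
  multiplexed_diagonal j _

variable [Fintype m]

theorem multiplexed_mul [NonUnitalNonAssocSemiring R] (j : κ)
    (A B : ({i // i ≠ j} → m) → Matrix m m R) :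
    multiplexed j (fun r => A r * B r) = multiplexed j A * multiplexed j B := by
  rw [multiplexed, multiplexed, multiplexed, submatrix_mul_equiv, blockDiagonal_mul]

theorem multiplexed_mulVec [NonUnitalNonAssocSemiring R] (j : κ)
    (A : ({i // i ≠ j} → m) → Matrix m m R) (v : (κ → m) → R) (x : κ → m) :
    (multiplexed j A *ᵥ v) x = ∑ b, A (fun i => x i) (x j) b * v (Function.update x j b) := by
  rw [multiplexed, submatrix_mulVec_equiv, Function.comp_apply, blockDiagonal_mulVec_apply]
  simp only [← funSplitAt_symm_eq_update]
  rfl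

theorem multiplexed_mem_unitaryGroup [CommRing R] [StarRing R] {j : κ}
    {A : ({i // i ≠ j} → m) → Matrix m m R} (hA : ∀ r, A r ∈ unitaryGroup m R) :
    multiplexed j A ∈ unitaryGroup (κ → m) R := by
  rw [mem_unitaryGroup_iff, star_multiplexed, ← multiplexed_mul]
  simp only [fun r => mem_unitaryGroup_iff.1 (hA r)]
  rw [← diagonal_one, multiplexed_diagonal, diagonal_one]

end Multiplexed

section Walsh

/-- The eigenvalue `±1` of Pauli `Z` on the basis vector `|a⟩`. -/
def bitSign (a : Fin 2) : ℝ := (-1) ^ (a : ℕ)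

theorem bitSign_add (a b : Fin 2) : bitSign (a + b) = bitSign a * bitSign b := by
  fin_cases a <;> fin_cases b <;> simp [bitSign]

theorem one_add_bitSign_mul_bitSign (a b : Fin 2) :
    (1 + bitSign a * bitSign b) / 2 = if a = b then 1 else 0 := by
  fin_cases a <;> fin_cases b <;> norm_num [bitSign]

variable {κ : Type*}

/-- The Walsh function `x ↦ ∏_{i ∈ S} (-1) ^ x i`, the character of `(ℤ/2)^κ` attached to `S`. -/
def walsh (S : Finset κ) (x : κ → Fin 2) : ℝ := ∏ i ∈ S, bitSign (x i)

/-- The indicator of `y` is `x ↦ ∏ᵢ (1 + (-1) ^ (x i + y i)) / 2`; expand it over subsets of `κ`. -/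
theorem span_range_walsh [Finite κ] :
    Submodule.span ℝ (Set.range (walsh (κ := κ))) = ⊤ := by
  classical
  cases nonempty_fintype κ
  rw [eq_top_iff, ← (Pi.basisFun ℝ (κ → Fin 2)).span_eq, Submodule.span_le]
  rintro _ ⟨y, rfl⟩
  have hexpand : Pi.basisFun ℝ (κ → Fin 2) y =
      (2⁻¹ : ℝ) ^ Fintype.card κ • ∑ S ∈ Finset.univ.powerset, walsh S y • walsh S := by
    ext x
    have hprod : (∏ i, (1 + bitSign (x i) * bitSign (y i)) / 2) = if x = y then 1 else 0 := by
      simp only [one_add_bitSign_mul_bitSign, Finset.prod_ite_zero]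
      simp [funext_iff]
    rw [Pi.basisFun_apply, Pi.single_apply, ← hprod, Finset.prod_div_distrib, Finset.prod_one_add]
    simp [walsh, Finset.prod_mul_distrib, div_eq_inv_mul, mul_comm]
  rw [hexpand]
  exact Submodule.smul_mem _ _ (Submodule.sum_mem _ fun S _ =>
    Submodule.smul_mem _ _ (Submodule.subset_span ⟨S, rfl⟩))

variable [DecidableEq κ]

/-- The controlled-not map on bit strings, with control `j` and target `k`. -/
def controlledNot (j k : κ) (x : κ → Fin 2) : κ → Fin 2 :=
  Function.update x k (x k + x j)

theorem walsh_comp_controlledNot {S : Finset κ} {j k : κ} (hj : j ∉ S) (hk : k ∈ S) :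
    walsh S ∘ controlledNot j k = walsh (insert j S) := by
  ext x
  have hupdate (i : κ) : bitSign (controlledNot j k x i) =
      Function.update (fun i => bitSign (x i)) k (bitSign (x k) * bitSign (x j)) i := by
    rw [controlledNot, Function.apply_update (fun _ => bitSign), bitSign_add]
  simp only [walsh, Function.comp_apply, hupdate]
  rw [Finset.prod_update_of_mem hk, Finset.prod_insert hj, Finset.sdiff_singleton_eq_erase,
    ← Finset.mul_prod_erase _ _ hk]
  ring

variable {V : Submodule ℝ ((κ → Fin 2) → ℝ)}

theorem walsh_mem_of_nonempty (hbit : ∀ j, walsh {j} ∈ V)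
    (hcnot : ∀ f ∈ V, ∀ j k, j ≠ k → f ∘ controlledNot j k ∈ V) {S : Finset κ}
    (hS : S.Nonempty) : walsh S ∈ V := by
  induction hS using Finset.Nonempty.cons_induction with
  | singleton j => exact hbit j
  | cons j S hj hS ih =>
    obtain ⟨k, hk⟩ := hS
    rw [Finset.cons_eq_insert, ← walsh_comp_controlledNot hj hk]
    exact hcnot _ ih j k (ne_of_mem_of_not_mem hk hj).symm

theorem walsh_empty_eq {j k : κ} (hjk : j ≠ k) :
    (walsh ∅ : (κ → Fin 2) → ℝ) = (4 : ℝ) • (fun x => if (x j, x k) = (1, 1) then 1 else 0) +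
      walsh {j} + walsh {k} - walsh {j, k} := by
  ext x
  simp only [walsh, Pi.add_apply, Pi.sub_apply, Pi.smul_apply, Finset.prod_empty,
    Finset.prod_pair hjk, Finset.prod_singleton]
  generalize x j = a
  generalize x k = b
  fin_cases a <;> fin_cases b <;> norm_num [bitSign, Pi.single_apply]

theorem eq_top_of_comp_controlledNot_mem [Finite κ] [Nontrivial κ] (hbit : ∀ j, walsh {j} ∈ V)
    (hpair : ∀ j k, j ≠ k → (fun x => if (x j, x k) = (1, 1) then 1 else 0) ∈ V)
    (hcnot : ∀ f ∈ V, ∀ j k, j ≠ k → f ∘ controlledNot j k ∈ V) : V = ⊤ := by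
  rw [eq_top_iff, ← span_range_walsh, Submodule.span_le]
  rintro _ ⟨S, rfl⟩
  rcases S.eq_empty_or_nonempty with rfl | hS
  · obtain ⟨j, k, hjk⟩ := exists_pair_ne κ
    rw [walsh_empty_eq hjk]
    exact sub_mem (add_mem (add_mem (V.smul_mem 4 (hpair j k hjk)) (hbit j)) (hbit k))
      (walsh_mem_of_nonempty hbit hcnot ⟨j, by simp⟩)
  · exact walsh_mem_of_nonempty hbit hcnot hS

end Walsh

section DiagonalHamiltonians

variable {ι : Type*} [Fintype ι] [DecidableEq ι]

/-- The Hamiltonians diagonal in the computational basis whose evolution stays in the monoid `P`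
at all times. -/
def diagonalHamiltonians (P : Submonoid (Matrix ι ι ℂ)) : Submodule ℝ (ι → ℝ) where
  carrier := {f | ∀ t : ℝ, phaseDiagonal (t • f) ∈ P}
  add_mem' hf hg t := by
    rw [smul_add, phaseDiagonal_add]
    exact mul_mem (hf t) (hg t)
  zero_mem' t := by
    rw [smul_zero, phaseDiagonal_zero]
    exact one_mem P
  smul_mem' c f hf t := by
    rw [smul_smul]
    exact hf (t * c)

theorem comp_mem_diagonalHamiltonians {P : Submonoid (Matrix ι ι ℂ)} {C : Matrix ι ι ℂ}
    (hC : C ∈ P) (hstar : star C ∈ P) (hunitary : C ∈ unitaryGroup ι ℂ) {σ : ι → ι}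
    (hσ : ∀ v, C *ᵥ v = v ∘ σ) {f : ι → ℝ} (hf : f ∈ diagonalHamiltonians P) :
    f ∘ σ ∈ diagonalHamiltonians P := by
  intro t
  have hcomm : phaseDiagonal (t • f ∘ σ) * C = C * phaseDiagonal (t • f) := by
    refine mulVec_injective (funext fun v => funext fun x => ?_)
    simp only [← mulVec_mulVec, hσ, phaseDiagonal_mulVec, Function.comp_apply, Pi.smul_apply]
  have hconj : phaseDiagonal (t • f ∘ σ) = C * phaseDiagonal (t • f) * star C := by
    rw [← hcomm, mul_assoc, mem_unitaryGroup_iff.1 hunitary, mul_one]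
  rw [hconj]
  exact mul_mem (mul_mem hC (hf t)) hstar

end DiagonalHamiltonians

section OneBitGates

theorem star_rotationGate (θ φ : ℝ) : star (rotationGate θ φ) = rotationGate (-θ) φ := by
  ext a b
  fin_cases a <;> fin_cases b <;>
    simp [rotationGate, star_apply, ← exp_conj, ← cos_conj, ← sin_conj]

theorem rotationGate_zero (φ : ℝ) : rotationGate 0 φ = 1 := by
  simp [rotationGate, one_fin_two]

theorem rotationGate_add (θ θ' φ : ℝ) :
    rotationGate (θ + θ') φ = rotationGate θ φ * rotationGate θ' φ := by
  have hexp : exp (I * φ) * exp (-(I * φ)) = 1 := by rw [← exp_add, add_neg_cancel, exp_zero]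
  simp only [rotationGate, mul_fin_two, EmbeddingLike.apply_eq_iff_eq, vecCons_inj, and_true,
    Real.cos_add, Real.sin_add]
  push_cast
  refine ⟨⟨?_, ?_⟩, ?_, ?_⟩
  · linear_combination -I ^ 2 * sin θ * sin θ' * hexp - sin θ * sin θ' * I_sq
  · ring
  · ring
  · linear_combination -I ^ 2 * sin θ * sin θ' * hexp - sin θ * sin θ' * I_sq

theorem rotationGate_mem_unitaryGroup (θ φ : ℝ) : rotationGate θ φ ∈ unitaryGroup (Fin 2) ℂ := by
  rw [mem_unitaryGroup_iff, star_rotationGate, ← rotationGate_add, add_neg_cancel,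
    rotationGate_zero]

theorem rotationGate_pi_div_two_mul (t : ℝ) :
    rotationGate (Real.pi / 2) t * rotationGate (-(Real.pi / 2)) 0 =
      phaseDiagonal (t • bitSign) := by
  have hI (z : ℂ) : I * z * I = -z := by linear_combination z * I_sq
  ext a b
  fin_cases a <;> fin_cases b <;> simp [rotationGate, phaseDiagonal, bitSign, mul_apply, hI]

/-- The pseudo-Hadamard gate: like the Hadamard gate it maps the eigenvectors of Pauli `Z` to
multiples of those of Pauli `X`, but it is itself one of the gates `U_{θ, φ}`. -/
noncomputable def pseudoHadamard : OneBitOp := rotationGate (Real.pi / 4) (-(Real.pi / 2))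

theorem pseudoHadamard_eq :
    pseudoHadamard = ((√2 / 2 : ℝ) : ℂ) • !![1, -1; 1, 1] := by
  have hexp : exp (I * (Real.pi / 2)) = I := by rw [mul_comm, exp_pi_div_two_mul_I]
  ext a b
  fin_cases a <;> fin_cases b <;>
    simp [pseudoHadamard, rotationGate, exp_neg, hexp, -ofReal_cos, -ofReal_sin]

theorem pseudoHadamard_mul_diagonal_mul_star (d : Fin 2 → ℂ) :
    pseudoHadamard * diagonal d * star pseudoHadamard =
      !![(d 0 + d 1) / 2, (d 0 - d 1) / 2; (d 0 - d 1) / 2, (d 0 + d 1) / 2] := by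
  have hsqrt : ((√2 / 2 : ℝ) : ℂ) * ((√2 / 2 : ℝ) : ℂ) = 1 / 2 := by
    rw [← ofReal_mul, div_mul_div_comm, Real.mul_self_sqrt zero_le_two]
    norm_num
  rw [pseudoHadamard_eq, star_smul, RCLike.star_def, conj_ofReal, Matrix.smul_mul,
    Matrix.smul_mul, Matrix.mul_smul, smul_smul, hsqrt]
  have hstar : star !![(1 : ℂ), -1; 1, 1] = !![1, 1; -1, 1] := by
    ext a b
    fin_cases a <;> fin_cases b <;> simp [star_apply]
  rw [hstar, diagonal_fin_two, mul_fin_two, mul_fin_two]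
  ext a b
  fin_cases a <;> fin_cases b <;> simp <;> ring

theorem pseudoHadamard_mul_phaseDiagonal_mul_star (θ : ℝ) :
    pseudoHadamard * phaseDiagonal (-θ • bitSign) * star pseudoHadamard = rotationGate θ 0 := by
  have hcos : (exp (-(I * θ)) + exp (I * θ)) / 2 = cos θ := by
    rw [Complex.cos, neg_mul, mul_comm, add_comm]
  have hsin : (exp (-(I * θ)) - exp (I * θ)) / 2 = -I * sin θ := by
    rw [Complex.sin, neg_mul (θ : ℂ), mul_comm (θ : ℂ)]
    linear_combination (exp (-(I * θ)) - exp (I * θ)) / 2 * I_sq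
  rw [phaseDiagonal, pseudoHadamard_mul_diagonal_mul_star]
  ext a b
  fin_cases a <;> fin_cases b <;> simp [rotationGate, bitSign, hcos, hsin]

theorem phaseDiagonal_mul_rotationGate_mul_phaseDiagonal (θ φ : ℝ) :
    phaseDiagonal ((φ / 2) • bitSign) * rotationGate θ 0 * phaseDiagonal (-(φ / 2) • bitSign) =
      rotationGate θ φ := by
  have hpos : exp (I * (φ / 2)) * exp (I * (φ / 2)) = exp (I * φ) := by
    rw [← exp_add, ← mul_add, add_halves]
  have hneg : exp (-(I * (φ / 2))) * exp (-(I * (φ / 2))) = exp (-(I * φ)) := by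
    rw [← exp_add, ← neg_add, ← mul_add, add_halves]
  have hone : exp (I * (φ / 2)) * exp (-(I * (φ / 2))) = 1 := by
    rw [← exp_add, add_neg_cancel, exp_zero]
  ext a b
  fin_cases a <;> fin_cases b <;> simp [rotationGate, bitSign, phaseDiagonal]
  · linear_combination cos θ * hone
  · linear_combination I * sin θ * hpos
  · linear_combination I * sin θ * hneg
  · linear_combination cos θ * hone

theorem rotationGate_eq_conj (θ φ : ℝ) :
    rotationGate θ φ = phaseDiagonal ((φ / 2) • bitSign) *
      (pseudoHadamard * phaseDiagonal (-θ • bitSign) * star pseudoHadamard) *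
      phaseDiagonal (-(φ / 2) • bitSign) := by
  rw [pseudoHadamard_mul_phaseDiagonal_mul_star, phaseDiagonal_mul_rotationGate_mul_phaseDiagonal]

theorem pseudoHadamard_mul_controlledPhase_mul_star (c : Fin 2) :
    pseudoHadamard * phaseDiagonal (fun a => if (c, a) = (1, 1) then Real.pi else 0) *
      star pseudoHadamard = of fun a b => if b = a + c then 1 else 0 := by
  rw [phaseDiagonal, pseudoHadamard_mul_diagonal_mul_star]
  ext a b
  fin_cases c <;> fin_cases a <;> fin_cases b <;> norm_num +decide [mul_comm I, exp_pi_mul_I]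

theorem exists_rotationGate_mulVec_eq_zero (v : Fin 2 → ℂ) :
    ∃ θ φ : ℝ, (rotationGate θ φ *ᵥ v) 1 = 0 := by
  set z : ℂ := ⟨‖v 0‖, ‖v 1‖⟩ with hz
  rcases eq_or_ne z 0 with h0 | h0
  · have hv : v = 0 := by
      ext i
      fin_cases i
      · simpa [hz] using congrArg re h0
      · simpa [hz] using congrArg im h0
    exact ⟨0, 0, by rw [hv, mulVec_zero, Pi.zero_apply]⟩
  · have hcos : (‖z‖ : ℂ) * cos z.arg = ‖v 0‖ := mod_cast norm_mul_cos_arg z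
    have hsin : (‖z‖ : ℂ) * sin z.arg = ‖v 1‖ := mod_cast norm_mul_sin_arg z
    have hpolar₀ : exp (-((v 0).arg * I)) * v 0 = ‖v 0‖ := by
      rw [exp_neg, inv_mul_eq_iff_eq_mul₀ (exp_ne_zero _), mul_comm, norm_mul_exp_arg_mul_I]
    have hpolar₁ : ‖v 1‖ * exp ((v 1).arg * I) = v 1 := norm_mul_exp_arg_mul_I (v 1)
    have hφ : exp (-(I * (((v 0).arg - (v 1).arg + Real.pi / 2 : ℝ) : ℂ))) =
        -I * exp (-((v 0).arg * I)) * exp ((v 1).arg * I) := by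
      rw [← exp_neg_pi_div_two_mul_I, ← exp_add, ← exp_add]
      push_cast
      ring_nf
    refine ⟨z.arg, (v 0).arg - (v 1).arg + Real.pi / 2, ?_⟩
    have hrow : (rotationGate z.arg ((v 0).arg - (v 1).arg + Real.pi / 2) *ᵥ v) 1 =
        cos z.arg * v 1 - exp ((v 1).arg * I) * sin z.arg * ‖v 0‖ := by
      simp only [rotationGate, mulVec, of_apply, vec2_dotProduct, cons_val_one, cons_val_zero, hφ,
        ofReal_cos, ofReal_sin]
      linear_combination exp (-((v 0).arg * I)) * exp ((v 1).arg * I) * sin z.arg * v 0 * I_sq -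
        exp ((v 1).arg * I) * sin z.arg * hpolar₀
    refine mul_left_cancel₀ (ofReal_ne_zero.2 (norm_ne_zero_iff.2 h0)) ?_
    rw [hrow]
    linear_combination v 1 * hcos - exp ((v 1).arg * I) * ‖v 0‖ * hsin - ‖v 0‖ * hpolar₁

end OneBitGates

section Elimination

variable {κ : Type*} [Fintype κ] [DecidableEq κ] {P : Submonoid (Matrix (κ → Fin 2) (κ → Fin 2) ℂ)}

theorem exists_multiplexed_rotationGate_mulVec_eq_zero (j : κ) (v : (κ → Fin 2) → ℂ) :
    ∃ θ φ : ({i // i ≠ j} → Fin 2) → ℝ, ∀ x : κ → Fin 2, x j = 1 →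
      (multiplexed j (fun r => rotationGate (θ r) (φ r)) *ᵥ v) x = 0 := by
  choose θ φ h using fun r : {i // i ≠ j} → Fin 2 =>
    exists_rotationGate_mulVec_eq_zero fun b => v ((Equiv.funSplitAt j (Fin 2)).symm (b, r))
  refine ⟨θ, φ, fun x hx => ?_⟩
  have hrow := h fun i => x i
  simp only [funSplitAt_symm_eq_update] at hrow
  rw [multiplexed_mulVec, hx]
  exact hrow

theorem exists_mem_mulVec_eq_zero
    (hP : ∀ j (θ φ : ({i // i ≠ j} → Fin 2) → ℝ),
      multiplexed j (fun r => rotationGate (θ r) (φ r)) ∈ P)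
    (v : (κ → Fin 2) → ℂ) (s : Finset κ) :
    ∃ M ∈ P, ∀ x : κ → Fin 2, ∀ i ∈ s, x i = 1 → (M *ᵥ v) x = 0 := by
  induction s using Finset.induction_on with
  | empty => exact ⟨1, one_mem P, by simp⟩
  | insert j s hj ih =>
    obtain ⟨M, hM, hMv⟩ := ih
    obtain ⟨θ, φ, hrot⟩ := exists_multiplexed_rotationGate_mulVec_eq_zero j (M *ᵥ v)
    refine ⟨_, mul_mem (hP j θ φ) hM, fun x i hi hx => ?_⟩
    rw [← mulVec_mulVec]
    rcases Finset.mem_insert.1 hi with rfl | his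
    · exact hrot x hx
    · have hij : i ≠ j := ne_of_mem_of_not_mem his hj
      rw [multiplexed_mulVec]
      refine Finset.sum_eq_zero fun b _ => ?_
      rw [hMv _ i his (by rw [Function.update_of_ne hij, hx]), mul_zero]

theorem exists_mem_mulVec_eq_single
    (hP : ∀ j (θ φ : ({i // i ≠ j} → Fin 2) → ℝ),
      multiplexed j (fun r => rotationGate (θ r) (φ r)) ∈ P)
    (v : (κ → Fin 2) → ℂ) : ∃ M ∈ P, ∃ x c, M *ᵥ v = Pi.single x c := by
  obtain ⟨M, hM, hMv⟩ := exists_mem_mulVec_eq_zero hP v Finset.univ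
  refine ⟨M, hM, 0, (M *ᵥ v) 0, funext fun x => ?_⟩
  rcases eq_or_ne x 0 with rfl | hx
  · rw [Pi.single_eq_same]
  · obtain ⟨i, hi⟩ := Function.ne_iff.1 hx
    rw [Pi.single_eq_of_ne hx, hMv x i (Finset.mem_univ i) (Fin.eq_one_of_ne_zero _ hi)]

end Elimination

section Gates

theorem phaseGate_eq_phaseDiagonal (η : ℝ) :
    phaseGate η = phaseDiagonal fun x => if x = (1, 1) then η else 0 := by
  rw [phaseGate, phaseDiagonal]
  congr 1
  ext x
  split_ifs <;> simp

theorem phaseGate_mem_unitaryGroup (η : ℝ) : phaseGate η ∈ unitaryGroup (Fin 2 × Fin 2) ℂ :=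
  phaseGate_eq_phaseDiagonal η ▸ phaseDiagonal_mem_unitaryGroup _

variable {n : ℕ}

theorem oneBitAt_eq_multiplexed (A : OneBitOp) (j : Fin n) :
    oneBitAt A j = multiplexed j fun _ => A := by
  ext x y
  simp only [oneBitAt, multiplexed, of_apply, submatrix_apply, blockDiagonal_apply]
  simp [funext_iff, Equiv.funSplitAt, Equiv.piSplitAt]

theorem twoBitAt_phaseGate (η : ℝ) (j k : Fin n) :
    twoBitAt (phaseGate η) j k =
      phaseDiagonal fun x => if (x j, x k) = (1, 1) then η else 0 := by
  ext x y
  rw [phaseGate_eq_phaseDiagonal, twoBitAt, of_apply, phaseDiagonal, phaseDiagonal]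
  rcases eq_or_ne x y with rfl | hxy
  · simp
  · rw [diagonal_apply_ne _ hxy, ite_eq_right_iff]
    intro h
    refine diagonal_apply_ne _ fun hjk => hxy (funext fun i => ?_)
    rcases eq_or_ne i j with rfl | hij
    · exact congrArg Prod.fst hjk
    rcases eq_or_ne i k with rfl | hik
    · exact congrArg Prod.snd hjk
    · exact h i hij hik

end Gates

/-- The operators on `n` qubits composed of the gates `U_{θ, φ}` and `Q_η` with arbitrary real
parameters. -/
def rotationPhaseMonoid (n : ℕ) : Submonoid (NBitOp n) :=
  Submonoid.closure
    (elementaryOps {A | ∃ θ φ, A = rotationGate θ φ} {B | ∃ η, B = phaseGate η} n)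

namespace rotationPhaseMonoid

variable {n : ℕ}

theorem rotationGate_mem (θ φ : ℝ) (j : Fin n) :
    multiplexed j (fun _ => rotationGate θ φ) ∈ rotationPhaseMonoid n := by
  rw [← oneBitAt_eq_multiplexed]
  exact Submonoid.subset_closure (.inl ⟨_, ⟨θ, φ, rfl⟩, j, rfl⟩)

theorem controlledPhase_mem (η : ℝ) {j k : Fin n} (hjk : j ≠ k) :
    phaseDiagonal (fun x => if (x j, x k) = (1, 1) then η else 0) ∈ rotationPhaseMonoid n := by
  rw [← twoBitAt_phaseGate]
  exact Submonoid.subset_closure (.inr ⟨_, ⟨η, rfl⟩, j, k, hjk, rfl⟩)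

theorem le_unitaryGroup : rotationPhaseMonoid n ≤ unitaryGroup (Fin n → Fin 2) ℂ := by
  refine Submonoid.closure_le.2 ?_
  rintro _ (⟨_, ⟨θ, φ, rfl⟩, j, rfl⟩ | ⟨_, ⟨η, rfl⟩, j, k, -, rfl⟩)
  · rw [oneBitAt_eq_multiplexed]
    exact multiplexed_mem_unitaryGroup fun _ => rotationGate_mem_unitaryGroup θ φ
  · rw [twoBitAt_phaseGate]
    exact phaseDiagonal_mem_unitaryGroup _

theorem star_mem {M : NBitOp n} (hM : M ∈ rotationPhaseMonoid n) :
    star M ∈ rotationPhaseMonoid n := by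
  induction hM using Submonoid.closure_induction with
  | one => exact (star_one (NBitOp n)).symm ▸ one_mem _
  | mul M N _ _ hM hN => exact star_mul M N ▸ mul_mem hN hM
  | mem M hM =>
    rcases hM with ⟨_, ⟨θ, φ, rfl⟩, j, rfl⟩ | ⟨_, ⟨η, rfl⟩, j, k, hjk, rfl⟩
    · rw [oneBitAt_eq_multiplexed, star_multiplexed]
      simp only [star_rotationGate]
      exact rotationGate_mem _ _ j
    · rw [twoBitAt_phaseGate, star_phaseDiagonal]
      convert controlledPhase_mem (-η) hjk using 3 with x
      rw [Pi.neg_apply, neg_ite, neg_zero]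

theorem pseudoHadamard_conj_mem {j : Fin n} {A : ({i // i ≠ j} → Fin 2) → OneBitOp}
    (hA : multiplexed j A ∈ rotationPhaseMonoid n) :
    multiplexed j (fun r => pseudoHadamard * A r * star pseudoHadamard) ∈
      rotationPhaseMonoid n := by
  have hV : multiplexed j (fun _ => pseudoHadamard) ∈ rotationPhaseMonoid n :=
    rotationGate_mem _ _ j
  rw [multiplexed_mul, multiplexed_mul, ← star_multiplexed]
  exact mul_mem (mul_mem hV hA) (star_mem hV)

/-- Conjugating `Q_π`, the controlled Pauli `Z`, by the pseudo-Hadamard gate on the target. -/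
theorem exists_mem_mulVec_eq_comp_controlledNot {j k : Fin n} (hjk : j ≠ k) :
    ∃ C ∈ rotationPhaseMonoid n, ∀ v, C *ᵥ v = v ∘ controlledNot j k := by
  have hphase : multiplexed k (fun r => phaseDiagonal fun a =>
      if (r ⟨j, hjk⟩, a) = (1, 1) then Real.pi else 0) ∈ rotationPhaseMonoid n := by
    rw [multiplexed_phaseDiagonal]
    exact controlledPhase_mem Real.pi hjk
  refine ⟨_, pseudoHadamard_conj_mem hphase, fun v => funext fun x => ?_⟩
  simp only [pseudoHadamard_mul_controlledPhase_mul_star, multiplexed_mulVec, of_apply, ite_mul,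
    one_mul, zero_mul, Finset.sum_ite_eq', Finset.mem_univ, if_true]
  rfl

theorem walsh_singleton_mem (j : Fin n) :
    walsh {j} ∈ diagonalHamiltonians (rotationPhaseMonoid n) := by
  intro t
  have hmul := mul_mem (rotationGate_mem (Real.pi / 2) t j)
    (rotationGate_mem (-(Real.pi / 2)) 0 j)
  rw [← multiplexed_mul, rotationGate_pi_div_two_mul, multiplexed_phaseDiagonal] at hmul
  convert hmul using 2
  ext x
  simp [walsh]

theorem diagonalHamiltonians_eq_top (hn : 2 ≤ n) :
    diagonalHamiltonians (rotationPhaseMonoid n) = ⊤ := by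
  have : Nontrivial (Fin n) := Fin.nontrivial_iff_two_le.2 hn
  refine eq_top_of_comp_controlledNot_mem walsh_singleton_mem (fun j k hjk t => ?_)
    fun f hf j k hjk => ?_
  · convert controlledPhase_mem t hjk using 3 with x
    simp
  · obtain ⟨C, hC, hCv⟩ := exists_mem_mulVec_eq_comp_controlledNot hjk
    exact comp_mem_diagonalHamiltonians hC (star_mem hC) (le_unitaryGroup hC) hCv hf

theorem phaseDiagonal_mem (hn : 2 ≤ n) (f : (Fin n → Fin 2) → ℝ) :
    phaseDiagonal f ∈ rotationPhaseMonoid n := by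
  have hf : f ∈ diagonalHamiltonians (rotationPhaseMonoid n) :=
    diagonalHamiltonians_eq_top hn ▸ Submodule.mem_top
  simpa using hf 1

theorem multiplexed_rotationGate_mem (hn : 2 ≤ n) (j : Fin n)
    (θ φ : ({i // i ≠ j} → Fin 2) → ℝ) :
    multiplexed j (fun r => rotationGate (θ r) (φ r)) ∈ rotationPhaseMonoid n := by
  have hdiag (f : ({i // i ≠ j} → Fin 2) → Fin 2 → ℝ) :
      multiplexed j (fun r => phaseDiagonal (f r)) ∈ rotationPhaseMonoid n := by
    rw [multiplexed_phaseDiagonal]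
    exact phaseDiagonal_mem hn _
  simp only [rotationGate_eq_conj (θ _)]
  rw [multiplexed_mul, multiplexed_mul]
  exact mul_mem (mul_mem (hdiag _) (pseudoHadamard_conj_mem (hdiag _))) (hdiag _)

theorem unitaryGroup_le (hn : 2 ≤ n) :
    unitaryGroup (Fin n → Fin 2) ℂ ≤ rotationPhaseMonoid n :=
  unitaryGroup_le_of_exists_mulVec_eq_single le_unitaryGroup (fun _ => star_mem)
    (phaseDiagonal_mem hn) (exists_mem_mulVec_eq_single (multiplexed_rotationGate_mem hn))

end rotationPhaseMonoid

theorem isUniversalGateSet_rotationGate_phaseGate :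
    IsUniversalGateSet {A | ∃ θ φ, A = rotationGate θ φ} {B | ∃ η, B = phaseGate η} := by
  refine ⟨?_, ?_, fun n hn W hW => ?_⟩
  · rintro _ ⟨θ, φ, rfl⟩
    exact rotationGate_mem_unitaryGroup θ φ
  · rintro _ ⟨η, rfl⟩
    exact phaseGate_mem_unitaryGroup η
  · exact Submonoid.exists_list_of_mem_closure (rotationPhaseMonoid.unitaryGroup_le hn hW)

section Periodicity

theorem exp_I_mul_congr {x y : ℝ} (h : (x : Real.Angle) = y) : exp (I * x) = exp (I * y) := by
  have hcircle := congrArg (fun a : Real.Angle => (a.toCircle : ℂ)) h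
  simpa only [Real.Angle.toCircle_coe, Circle.coe_exp, mul_comm I] using hcircle

theorem rotationGate_congr {θ θ' φ φ' : ℝ} (hθ : (θ : Real.Angle) = θ')
    (hφ : (φ : Real.Angle) = φ') : rotationGate θ φ = rotationGate θ' φ' := by
  rw [rotationGate, rotationGate, ← Real.Angle.cos_coe, ← Real.Angle.sin_coe, hθ,
    Real.Angle.cos_coe, Real.Angle.sin_coe, exp_neg, exp_neg, exp_I_mul_congr hφ]

theorem phaseGate_congr {η η' : ℝ} (h : (η : Real.Angle) = η') : phaseGate η = phaseGate η' := by
  rw [phaseGate, phaseGate, exp_I_mul_congr h]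

theorem exists_le_le_coe_angle_eq (a x : ℝ) :
    ∃ y, a ≤ y ∧ y ≤ a + 2 * Real.pi ∧ (y : Real.Angle) = x :=
  have hmem := toIcoMod_mem_Ico Real.two_pi_pos a x
  ⟨_, hmem.1, hmem.2.le, Real.Angle.coe_toIcoMod x a⟩

theorem exists_nonneg_le_coe_angle_eq (x : ℝ) :
    ∃ y, 0 ≤ y ∧ y ≤ 2 * Real.pi ∧ (y : Real.Angle) = x := by
  simpa only [zero_add] using exists_le_le_coe_angle_eq 0 x

theorem exists_nonneg_coe_angle_mul_eq {c : ℝ} (hc : c ≠ 0) (x : ℝ) :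
    ∃ t, 0 ≤ t ∧ ((c * t : ℝ) : Real.Angle) = x := by
  rcases hc.lt_or_gt with hneg | hpos
  · obtain ⟨y, -, hy, hyx⟩ := exists_le_le_coe_angle_eq (-(2 * Real.pi)) x
    rw [neg_add_cancel] at hy
    exact ⟨y / c, div_nonneg_of_nonpos hy hneg.le, by rw [mul_div_cancel₀ y hc, hyx]⟩
  · obtain ⟨y, hy, -, hyx⟩ := exists_nonneg_le_coe_angle_eq x
    exact ⟨y / c, div_nonneg hy hpos.le, by rw [mul_div_cancel₀ y hc, hyx]⟩

theorem setOf_rotationGate_le_two_pi :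
    {A | ∃ θ φ : ℝ, 0 ≤ θ ∧ θ ≤ 2 * Real.pi ∧ 0 ≤ φ ∧ φ ≤ 2 * Real.pi ∧ A = rotationGate θ φ} =
      {A | ∃ θ φ, A = rotationGate θ φ} := by
  refine Set.Subset.antisymm ?_ ?_
  · rintro _ ⟨θ, φ, -, -, -, -, rfl⟩
    exact ⟨θ, φ, rfl⟩
  · rintro _ ⟨θ, φ, rfl⟩
    obtain ⟨θ', hθ₀, hθ₁, hθ⟩ := exists_nonneg_le_coe_angle_eq θ
    obtain ⟨φ', hφ₀, hφ₁, hφ⟩ := exists_nonneg_le_coe_angle_eq φ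
    exact ⟨θ', φ', hθ₀, hθ₁, hφ₀, hφ₁, rotationGate_congr hθ.symm hφ.symm⟩

theorem setOf_phaseGate_le_two_pi :
    {B | ∃ η : ℝ, 0 ≤ η ∧ η ≤ 2 * Real.pi ∧ B = phaseGate η} = {B | ∃ η, B = phaseGate η} := by
  refine Set.Subset.antisymm ?_ ?_
  · rintro _ ⟨η, -, -, rfl⟩
    exact ⟨η, rfl⟩
  · rintro _ ⟨η, rfl⟩
    obtain ⟨η', hη₀, hη₁, hη⟩ := exists_nonneg_le_coe_angle_eq η
    exact ⟨η', hη₀, hη₁, phaseGate_congr hη.symm⟩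

theorem twoLevelAtomGates_eq {Ω : ℝ} (hΩ : Ω ≠ 0) :
    twoLevelAtomGates Ω = {A | ∃ θ φ, A = rotationGate θ φ} := by
  refine Set.Subset.antisymm ?_ ?_
  · rintro _ ⟨t, φ, -, -, -, rfl⟩
    exact ⟨_, φ, rfl⟩
  · rintro _ ⟨θ, φ, rfl⟩
    obtain ⟨t, ht, hθ⟩ := exists_nonneg_coe_angle_mul_eq (div_ne_zero hΩ two_ne_zero) θ
    obtain ⟨φ', hφ₀, hφ₁, hφ⟩ := exists_nonneg_le_coe_angle_eq φ
    exact ⟨t, φ', ht, hφ₀, hφ₁, rotationGate_congr hθ.symm hφ.symm⟩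

theorem cavityGates_eq {ħ ω ν g : ℝ} (hE : cavityEnergy ħ ω ν g / ħ ≠ 0) :
    cavityGates ħ ω ν g = {B | ∃ η, B = phaseGate η} := by
  refine Set.Subset.antisymm ?_ ?_
  · rintro _ ⟨t, -, rfl⟩
    exact ⟨_, rfl⟩
  · rintro _ ⟨η, rfl⟩
    obtain ⟨t, ht, hη⟩ := exists_nonneg_coe_angle_mul_eq (neg_ne_zero.2 hE) η
    exact ⟨t, ht, phaseGate_congr hη.symm⟩

end Periodicity

theorem theorem3p4 :
    IsUniversalGateSet
      {A | ∃ θ φ : ℝ, 0 ≤ θ ∧ θ ≤ 2 * Real.pi ∧ 0 ≤ φ ∧ φ ≤ 2 * Real.pi ∧ A = rotationGate θ φ}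
      {B | ∃ η : ℝ, 0 ≤ η ∧ η ≤ 2 * Real.pi ∧ B = phaseGate η} ∧
    ∀ Ω ħ ω ν g : ℝ, 0 < Ω → 0 < ħ → 0 < g → ν ≠ ω → cavityEnergy ħ ω ν g ≠ 0 →
      IsUniversalGateSet (twoLevelAtomGates Ω) (cavityGates ħ ω ν g) := by
  refine ⟨?_, fun Ω ħ ω ν g hΩ hħ _ _ hE => ?_⟩
  · rw [setOf_rotationGate_le_two_pi, setOf_phaseGate_le_two_pi]
    exact isUniversalGateSet_rotationGate_phaseGate
  · rw [twoLevelAtomGates_eq hΩ.ne', cavityGates_eq (div_ne_zero hE hħ.ne')]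
    exact isUniversalGateSet_rotationGate_phaseGate
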